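/- Let $0<q<1$ and $q^*=2-q$. For $p\in\{q,q^*\}$ put $\exp_p(u)=[1+(1-p)u]_+^{1/(1-p)}\in[0,+\infty]$ (with $0$ to a negative power equal to $+\infty$, and $\exp_p(\pm\infty)$ defined as the limits) and $\ln_p(u)=\frac{u^{1-p}-1}{1-p}$ for $u>0$. Let $X_1,X_2,\dots$ be i.i.d. real-valued random variables and assume that $A(a)=\mathbb E\exp_q(aX_1)$ is finite for all $a>0$. Put $\theta(a)=a/A(a)^{1-q}$ for $a>0$ (equal to $+\infty$ if $A(a)=0$) and $\overline\theta=\lim_{a\to\infty}\theta(a)\le+\infty$. On $\{a>0: A(a)>0\}$ the function $\theta$ is strictly increasing with range $(0,\overline\theta)$; for $0<\theta<\overline\theta$ put $\Phi(\theta)=\ln_{q^*}A(a)$, where $a>0$ is determined by $\theta(a)=\theta$. Let $$I(x)=\sup\{\theta x-\Phi(\theta):\ 0<\theta<\overline\theta\}\le+\infty .$$ Then there exist functions $\xi_n:\mathbb R\to[0,+\infty]$, $n\ge1$, such that for all $x\in\mathbb R$ and all $n\ge 1$ $$\mathrm{Prob}\Big(\frac1n\sum_{k=1}^nX_k\ge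 x\Big)\le\xi_n(x),$$ and such that for every $x\in\mathbb R$ $$\xi_n(x)\sim n\,\exp_{q^*}\Big(\frac nq-nI(x)\Big)\qquad(n\to\infty).$$ Here $f_n\sim g_n$ for sequences in $[0,+\infty]$ means that $f_n=u_ng_n$ for all large $n$, for some $u_n\to1$. -/

import Mathlib

open MeasureTheory ProbabilityTheory Filter Topology
open scoped ENNReal

namespace QDeformed

noncomputable section

/-- The `q`-deformed exponential `exp_q(u) = [1 + (1 - q) u]_+ ^ (1 / (1 - q))`, with values in
`[0, +∞]`. It is extended to `u = ±∞` by its limits. For `q > 1` the exponent is negative, and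
`0` to a negative power is `+∞`. -/
def qExp (q : ℝ) (u : EReal) : ℝ≥0∞ :=
  (1 + ((1 - q : ℝ) : EReal) * u).toENNReal ^ (1 / (1 - q))

/-- The `q`-deformed logarithm `ln_q(u) = (u ^ (1 - q) - 1) / (1 - q)`, for `u > 0`. -/
def qLog (q : ℝ) (u : ℝ) : ℝ :=
  (u ^ (1 - q) - 1) / (1 - q)

variable {Ω : Type*} [MeasurableSpace Ω]

/-- The `q`-deformed generating function `A(a) = E exp_q(a X)`, with values in `[0, +∞]`. -/
def genFun (q : ℝ) (P : Measure Ω) (X : Ω → ℝ) (a : ℝ) : ℝ≥0∞ :=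
  ∫⁻ ω, qExp q ((a * X ω : ℝ) : EReal) ∂P

/-- The parameter `θ(a) = a / A(a) ^ (1 - q)`. It is `+∞` if `A(a) = 0`. -/
def theta (q : ℝ) (P : Measure Ω) (X : Ω → ℝ) (a : ℝ) : ℝ≥0∞ :=
  ENNReal.ofReal a / genFun q P X a ^ (1 - q)

/-- The limit `θ̄` of `θ(a)` as `a → ∞` (the limit exists since `θ` is increasing in `a`). -/
def thetaBar (q : ℝ) (P : Measure Ω) (X : Ω → ℝ) : ℝ≥0∞ :=
  limsup (theta q P X) atTop

/-- The inverse `a(θ)` of `a ↦ θ(a)`, `a > 0`. -/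
def aOfTheta (q : ℝ) (P : Measure Ω) (X : Ω → ℝ) (t : ℝ) : ℝ :=
  Function.invFunOn (theta q P X) (Set.Ioi 0) (ENNReal.ofReal t)

/-- `Φ(θ) = ln_{q*} A(a(θ))` with `q* = 2 - q`, for `0 < θ < θ̄`. -/
def Phi (q : ℝ) (P : Measure Ω) (X : Ω → ℝ) (t : ℝ) : ℝ :=
  qLog (2 - q) (genFun q P X (aOfTheta q P X t)).toReal

/-- The rate function `I(x) = sup {θ x - Φ(θ) : 0 < θ < θ̄}`, possibly `+∞`. -/
def rate (q : ℝ) (P : Measure Ω) (X : Ω → ℝ) (x : ℝ) : EReal :=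
  ⨆ t ∈ {t : ℝ | 0 < t ∧ ENNReal.ofReal t < thetaBar q P X},
    ((t * x - Phi q P X t : ℝ) : EReal)

/-- Asymptotic equivalence `f n ~ g n` as `n → ∞` of sequences in `[0, +∞]`: the quotient tends
to `1`. Where `g n` is `0` or `+∞`, this forces `f n = g n` for all large `n`. -/
def AsympEquiv (f g : ℕ → ℝ≥0∞) : Prop :=
  ∃ u : ℕ → ℝ≥0∞, Tendsto u atTop (𝓝 1) ∧ ∀ᶠ n in atTop, f n = u n * g n

end

end QDeformed

/-! ### Tails of sums of nonnegative variables with a finite moment of order `α > 1` -/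

namespace QDeformed

/-! Take for `ξ n x` the maximum of the probability and the target `n exp_{q*}(n/q - n I(x))`; it
then suffices that the target dominates for all large `n`, with `x` fixed. If `I(x) ≤ 1/q`, the
target is at least `1`. If `I(x) = ∞`, a Markov bound forces `X < x` almost surely, so the
probability vanishes.

In the remaining case put `α = 1/(1-q)`. The target is of exact order `n^(1-α)`, so a probability of
`o(n^(1-α))` is enough. Some `a > 0` satisfies `1 + (1-q)ax > A(a)^(1-q)`. The variables `Z_k = [1 +
(1-q)a X_k]_+` have `α`-th moment `A(a)`, hence mean at most `A(a)^(1-q)`, and their sum must exceed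
`n(1 + (1-q)ax)`. `tendsto_rpow_mul_measureReal_sum` gives the required decay: a summand above `δn`
has total probability `o(n^(1-α))`, and the truncated sum is handled by a Chernoff bound. -/

/-- The remainder is of order `p`, not `2`, because only moments up to order `α`, possibly below
`2`, are available. -/
theorem exp_le_one_add_add_rpow_mul_exp {y p : ℝ} (hy : 0 ≤ y) (hp : 1 < p) (hp2 : p ≤ 2) :
    Real.exp y ≤ 1 + y + y ^ p * Real.exp y := by
  have h1 : 1 ≤ Real.exp y := Real.one_le_exp hy
  rcases le_total y 1 with h | h
  · have h2 : |Real.exp y - 1 - y| ≤ y ^ 2 :=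
      Real.abs_exp_sub_one_sub_id_le (by rwa [abs_of_nonneg hy])
    have h3 : y ^ (2 : ℝ) ≤ y ^ p := by
      rcases hy.eq_or_lt with rfl | hy'
      · rw [Real.zero_rpow (by norm_num), Real.zero_rpow (by linarith)]
      · exact Real.rpow_le_rpow_of_exponent_ge hy' h hp2
    rw [Real.rpow_two] at h3
    have h4 : y ^ p ≤ y ^ p * Real.exp y := le_mul_of_one_le_right (by positivity) h1
    linarith [(abs_le.1 h2).2]
  · have h3 : 1 ≤ y ^ p := Real.one_le_rpow h (by linarith)
    nlinarith

variable {Ω : Type*} [MeasurableSpace Ω] {P : Measure Ω}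

/-- The tail of a random variable with a finite moment of order `α` is `o(n ^ (-α))`. -/
theorem tendsto_rpow_mul_measureReal_lt [IsProbabilityMeasure P] {Z : Ω → ℝ} (hZ : Measurable Z)
    {α δ : ℝ} (hα : 0 < α) (hδ : 0 < δ)
    (hint : Integrable (fun ω => Z ω ^ α) P) :
    Tendsto (fun n : ℕ => (n : ℝ) ^ α * P.real {ω | δ * n < Z ω}) atTop (𝓝 0) := by
  have hS (n : ℕ) : MeasurableSet {ω | δ * n < Z ω} := measurableSet_lt measurable_const hZ
  have key : Tendsto (fun n : ℕ => ∫ ω, Set.indicator {ω | δ * n < Z ω}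
      (fun _ => (n : ℝ) ^ α) ω ∂P) atTop (𝓝 (∫ _, (0 : ℝ) ∂P)) := by
    -- On the event, `n^α ≤ (Z/δ)^α`; for fixed `ω` the indicator vanishes once `n ≥ Z/δ`.
    refine tendsto_integral_of_dominated_convergence (fun ω => δ ^ (-α) * |Z ω ^ α|)
      (fun n => (measurable_const.indicator (hS n)).aestronglyMeasurable)
      (hint.abs.const_mul _) (fun n => ae_of_all _ fun ω => ?_) (ae_of_all _ fun ω => ?_)
    · by_cases h : δ * n < Z ω
      · rw [Set.indicator_of_mem (by exact h), Real.norm_of_nonneg (by positivity)]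
        have hz : 0 < Z ω := lt_of_le_of_lt (by positivity) h
        rw [abs_of_nonneg (by positivity), Real.rpow_neg hδ.le, ← div_eq_inv_mul,
          le_div_iff₀ (by positivity), ← Real.mul_rpow (by positivity) hδ.le]
        exact Real.rpow_le_rpow (by positivity) (by linarith) hα.le
      · rw [Set.indicator_of_notMem (by exact h), norm_zero]
        positivity
    · refine tendsto_const_nhds.congr' ?_
      have : ∀ᶠ n : ℕ in atTop, Z ω / δ ≤ n :=
        tendsto_natCast_atTop_atTop.eventually_ge_atTop _
      filter_upwards [this] with n hn
      rw [Set.indicator_of_notMem]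
      simp only [Set.mem_ofPred_eq, not_lt]
      rwa [div_le_iff₀' hδ] at hn
  simp only [integral_zero] at key
  refine key.congr fun n => ?_
  rw [integral_indicator_const _ (hS n), smul_eq_mul, mul_comm]

/-- Chernoff bound for the sum of truncated nonnegative random variables. -/
theorem measureReal_sum_min_le [IsProbabilityMeasure P] {Z : ℕ → Ω → ℝ}
    (hZ : ∀ k, Measurable (Z k)) (hindep : iIndepFun Z P)
    (hident : ∀ k, IdentDistrib (Z k) (Z 0) P P) (hnn : ∀ ω, 0 ≤ Z 0 ω)
    {p : ℝ} (hp : 1 < p) (hp2 : p ≤ 2) (hint : Integrable (Z 0) P)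
    (hintp : Integrable (fun ω => Z 0 ω ^ p) P) {s K : ℝ} (hs : 0 ≤ s) (hK : 0 ≤ K) (r : ℝ)
    (n : ℕ) :
    P.real {ω | n * r ≤ ∑ k ∈ Finset.range n, min (Z k ω) K} ≤
      Real.exp (-s * (n * r) + n * (s * (∫ ω, Z 0 ω ∂P) +
        s ^ p * Real.exp (s * K) * ∫ ω, Z 0 ω ^ p ∂P)) := by
  have hg : Measurable fun z : ℝ => min z K := measurable_id.min measurable_const
  set W : ℕ → Ω → ℝ := fun k ω => min (Z k ω) K with hW
  have hWm (k : ℕ) : Measurable (W k) := hg.comp (hZ k)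
  have hWi : iIndepFun W P := hindep.comp (fun _ z => min z K) fun _ => hg
  have hWd (k : ℕ) : IdentDistrib (W k) (W 0) P P := (hident k).comp hg
  have hexp (k : ℕ) : Integrable (fun ω => Real.exp (s * W k ω)) P := by
    refine Integrable.of_bound
      ((Real.measurable_exp.comp ((hWm k).const_mul s)).aestronglyMeasurable)
      (Real.exp (s * K)) (ae_of_all _ fun ω => ?_)
    rw [Real.norm_of_nonneg (Real.exp_pos _).le]
    exact Real.exp_le_exp.2 (mul_le_mul_of_nonneg_left (min_le_right _ _) hs)
  have hmgf0 : mgf (W 0) P s ≤ Real.exp (s * (∫ ω, Z 0 ω ∂P) +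
        s ^ p * Real.exp (s * K) * ∫ ω, Z 0 ω ^ p ∂P) := by
    have hi1 : Integrable (fun ω => 1 + s * Z 0 ω) P :=
      (integrable_const 1).add (hint.const_mul s)
    have hi2 : Integrable (fun ω => s ^ p * Real.exp (s * K) * Z 0 ω ^ p) P := hintp.const_mul _
    have h1 : mgf (W 0) P s ≤ ∫ ω, (1 + s * Z 0 ω + s ^ p * Real.exp (s * K) * Z 0 ω ^ p) ∂P := by
      refine integral_mono (hexp 0) (hi1.add hi2) fun ω => ?_
      have hw0 : 0 ≤ W 0 ω := le_min (hnn ω) hK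
      have hwZ : W 0 ω ≤ Z 0 ω := min_le_left _ _
      have hwK : W 0 ω ≤ K := min_le_right _ _
      refine (exp_le_one_add_add_rpow_mul_exp (mul_nonneg hs hw0) hp hp2).trans ?_
      rw [Real.mul_rpow hs hw0, mul_right_comm]
      have := hnn ω
      gcongr
    refine h1.trans ?_
    rw [integral_add hi1 hi2, integral_add (integrable_const _) (hint.const_mul _), integral_const_mul,
      integral_const_mul]
    simp only [integral_const, probReal_univ, smul_eq_mul, mul_one]
    rw [add_assoc, add_comm]
    exact Real.add_one_le_exp _
  have hmgf : mgf (∑ k ∈ Finset.range n, W k) P s = mgf (W 0) P s ^ n := by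
    rw [hWi.mgf_sum hWm, Finset.prod_congr rfl fun k _ => mgf_congr_of_identDistrib (W k) (W 0) (hWd k) s]
    simp
  have hch := measure_ge_le_exp_mul_mgf (μ := P) (X := ∑ k ∈ Finset.range n, W k) (n * r) hs
    (hWi.integrable_exp_mul_sum hWm fun k _ => hexp k)
  simp only [Finset.sum_apply] at hch
  refine hch.trans ?_
  rw [hmgf, Real.exp_add, Real.exp_nat_mul]
  gcongr
  exact mgf_nonneg

theorem tendsto_log_rpow_mul_rpow_neg (p : ℝ) {c : ℝ} (hc : 0 < c) :
    Tendsto (fun x : ℝ => Real.log x ^ p * x ^ (-c)) atTop (𝓝 0) := by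
  refine ((isLittleO_log_rpow_rpow_atTop p hc).tendsto_div_nhds_zero).congr' ?_
  filter_upwards [eventually_gt_atTop 0] with x hx
  rw [Real.rpow_neg hx.le, div_eq_mul_inv]

/-- Sums of nonnegative i.i.d. random variables with a finite moment of order `α > 1` exceed
`n r`, with `r` above the mean, with probability `o(n ^ (1 - α))`. -/
theorem tendsto_rpow_mul_measureReal_sum [IsProbabilityMeasure P] {Z : ℕ → Ω → ℝ}
    (hZ : ∀ k, Measurable (Z k)) (hindep : iIndepFun Z P)
    (hident : ∀ k, IdentDistrib (Z k) (Z 0) P P) (hnn : ∀ ω, 0 ≤ Z 0 ω)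
    {α r : ℝ} (hα : 1 < α) (hint : Integrable (fun ω => Z 0 ω ^ α) P)
    (hr : ∫ ω, Z 0 ω ∂P < r) :
    Tendsto (fun n : ℕ => (n : ℝ) ^ (α - 1) *
      P.real {ω | n * r ≤ ∑ k ∈ Finset.range n, Z k ω}) atTop (𝓝 0) := by
  have hintp {p : ℝ} (hp : 1 ≤ p) (hpα : p ≤ α) : Integrable (fun ω => Z 0 ω ^ p) P := by
    refine Integrable.mono' ((integrable_const (1 : ℝ)).add hint)
      (((hZ 0).pow_const p).aestronglyMeasurable) (ae_of_all _ fun ω => ?_)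
    have h0 := hnn ω
    rw [Real.norm_of_nonneg (by positivity)]
    simp only [Pi.add_apply]
    rcases le_total (Z 0 ω) 1 with h | h
    · have := Real.rpow_le_one h0 h (by linarith : 0 ≤ p)
      have : 0 ≤ Z 0 ω ^ α := by positivity
      linarith
    · have := Real.rpow_le_rpow_of_exponent_le h hpα
      linarith
  set m := ∫ ω, Z 0 ω ∂P with hm
  obtain ⟨p, hp, hp2, hpα⟩ : ∃ p : ℝ, 1 < p ∧ p ≤ 2 ∧ p ≤ α :=
    ⟨min α 2, lt_min hα (by norm_num), min_le_right _ _, min_le_left _ _⟩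
  have hint1 : Integrable (Z 0) P := by simpa using hintp le_rfl hα.le
  set M := ∫ ω, Z 0 ω ^ p ∂P with hM
  -- With `s = l log n / n`, the linear part of the Chernoff exponent is `-l (r - m) log n = -α log
  -- n`. The choice of `δ` makes `exp(s δ n) = n^((p-1)/2)`, so the remainder `n s^p exp(s δ n) M`
  -- is of order `(log n)^p n^(-(p-1)/2)`.
  set l := α / (r - m) with hl
  have hrm : 0 < r - m := by linarith
  have hl0 : 0 < l := by positivity
  set δ := (p - 1) / (2 * l) with hδ
  have hδ0 : 0 < δ := div_pos (by linarith) (by positivity)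
  have hlδ : l * δ = (p - 1) / 2 := by rw [hδ]; field_simp
  have hlr : l * (r - m) = α := by rw [hl]; field_simp
  have hbig := tendsto_rpow_mul_measureReal_lt (hZ 0) (by linarith : 0 < α) hδ0 hint
  have hexpo : Tendsto (fun n : ℕ => Real.exp (-Real.log n +
      l ^ p * M * (Real.log n ^ p * (n : ℝ) ^ (-((p - 1) / 2))))) atTop (𝓝 0) := by
    refine Real.tendsto_exp_atBot.comp ?_
    have h1 : Tendsto (fun n : ℕ => -Real.log n) atTop atBot :=
      tendsto_neg_atTop_atBot.comp (Real.tendsto_log_atTop.comp tendsto_natCast_atTop_atTop)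
    have h2 := (((tendsto_log_rpow_mul_rpow_neg p (by linarith : 0 < (p - 1) / 2)).comp
      tendsto_natCast_atTop_atTop).const_mul (l ^ p * M))
    exact h1.atBot_add h2
  have hsum := hbig.add hexpo
  rw [add_zero] at hsum
  refine squeeze_zero' (Eventually.of_forall fun n => by positivity) ?_ hsum
  filter_upwards [eventually_ge_atTop 1] with n hn
  have hn0 : (0 : ℝ) < n := by exact_mod_cast hn
  have hlog : 0 ≤ Real.log n := Real.log_nonneg (by exact_mod_cast hn)
  have hsub : {ω | n * r ≤ ∑ k ∈ Finset.range n, Z k ω} ⊆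
      (⋃ k ∈ Finset.range n, {ω | δ * n < Z k ω}) ∪
        {ω | n * r ≤ ∑ k ∈ Finset.range n, min (Z k ω) (δ * n)} := by
    intro ω hω
    by_cases h : ∃ k ∈ Finset.range n, δ * n < Z k ω
    · obtain ⟨k, hk, hk'⟩ := h
      exact Or.inl (Set.mem_biUnion hk hk')
    · push Not at h
      refine Or.inr ?_
      have : ∑ k ∈ Finset.range n, min (Z k ω) (δ * n) = ∑ k ∈ Finset.range n, Z k ω :=
        Finset.sum_congr rfl fun k hk => min_eq_left (h k hk)
      simpa only [Set.mem_ofPred_eq, this] using hω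
  have hU : P.real (⋃ k ∈ Finset.range n, {ω | δ * n < Z k ω}) ≤
      n * P.real {ω | δ * n < Z 0 ω} := by
    refine (measureReal_biUnion_finset_le _ _).trans (le_of_eq ?_)
    have (k : ℕ) : P.real {ω | δ * n < Z k ω} = P.real {ω | δ * n < Z 0 ω} := by
      have := (hident k).measure_mem_eq (measurableSet_Ioi (a := δ * n))
      simp only [Measure.real]
      exact congrArg ENNReal.toReal this
    simp [this]
  have hT := measureReal_sum_min_le hZ hindep hident hnn hp hp2 hint1 (hintp hp.le hpα)
    (s := l * Real.log n / n) (K := δ * n) (by positivity) (by positivity) r n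
  have hE : (n : ℝ) ^ (α - 1) * Real.exp (-(l * Real.log n / n) * (n * r) +
      n * (l * Real.log n / n * m +
        (l * Real.log n / n) ^ p * Real.exp (l * Real.log n / n * (δ * n)) * M)) =
      Real.exp (-Real.log n +
        l ^ p * M * (Real.log n ^ p * (n : ℝ) ^ (-((p - 1) / 2)))) := by
    have e1 : Real.exp (l * Real.log n / n * (δ * n)) = (n : ℝ) ^ ((p - 1) / 2) := by
      rw [Real.rpow_def_of_pos hn0, ← hlδ]
      congr 1
      field_simp
    have e2 : (n : ℝ) * ((l * Real.log n / n) ^ p * (n : ℝ) ^ ((p - 1) / 2)) =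
        l ^ p * (Real.log n ^ p * (n : ℝ) ^ (-((p - 1) / 2))) := by
      rw [Real.div_rpow (by positivity) hn0.le, Real.mul_rpow hl0.le hlog]
      have : (n : ℝ) ^ (-((p - 1) / 2)) = n * ((n : ℝ) ^ p)⁻¹ * (n : ℝ) ^ ((p - 1) / 2) := by
        nth_rewrite 2 [← Real.rpow_one (n : ℝ)]
        rw [← Real.rpow_neg hn0.le, ← Real.rpow_add hn0, ← Real.rpow_add hn0]
        congr 1
        ring
      rw [this]
      ring
    rw [e1, Real.rpow_def_of_pos hn0, ← Real.exp_add]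
    congr 1
    have e3 : -(l * Real.log n / n) * (n * r) + n * (l * Real.log n / n * m) =
        -(α * Real.log n) := by
      rw [← hlr]
      field_simp
      ring
    linear_combination e3 + M * e2
  calc (n : ℝ) ^ (α - 1) * P.real {ω | n * r ≤ ∑ k ∈ Finset.range n, Z k ω}
      ≤ (n : ℝ) ^ (α - 1) * (n * P.real {ω | δ * n < Z 0 ω} +
          Real.exp (-(l * Real.log n / n) * (n * r) +
      n * (l * Real.log n / n * m +
        (l * Real.log n / n) ^ p * Real.exp (l * Real.log n / n * (δ * n)) * M))) := by
        gcongr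
        exact (measureReal_mono hsub).trans ((measureReal_union_le _ _).trans (add_le_add hU hT))
    _ = _ := by
        rw [mul_add, hE, ← mul_assoc, ← Real.rpow_add_one hn0.ne', sub_add_cancel]

end QDeformed

/-! ### The parameter `a`, the rate function and the moments of `[1 + (1-q)aX]_+` -/

namespace QDeformed

theorem qExp_coe (q u : ℝ) :
    qExp q (u : EReal) = ENNReal.ofReal (1 + (1 - q) * u) ^ (1 / (1 - q)) := by
  have : (1 : EReal) + ((1 - q : ℝ) : EReal) * (u : EReal) = ((1 + (1 - q) * u : ℝ) : EReal) := by
    push_cast; rfl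
  rw [qExp, this, EReal.real_coe_toENNReal]

variable {Ω : Type*} [MeasurableSpace Ω] {P : Measure Ω} {X : Ω → ℝ} {q : ℝ}

theorem genFun_eq (q : ℝ) (P : Measure Ω) (X : Ω → ℝ) (a : ℝ) :
    genFun q P X a = ∫⁻ ω, ENNReal.ofReal (1 + (1 - q) * (a * X ω)) ^ (1 / (1 - q)) ∂P := by
  simp only [genFun, qExp_coe]

theorem genFun_zero [IsProbabilityMeasure P] : genFun q P X 0 = 1 := by
  simp [genFun_eq]

theorem continuousOn_genFun [IsProbabilityMeasure P] (hX : Measurable X) (hq1 : q < 1)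
    (hA : ∀ a : ℝ, 0 < a → genFun q P X a < ∞) :
    ContinuousOn (genFun q P X) (Set.Ici 0) := by
  intro b hb
  have hq : 0 < 1 - q := by linarith
  have he : 0 ≤ 1 / (1 - q) := by positivity
  have hb0 : 0 ≤ b := hb
  change Tendsto (genFun q P X) (𝓝[Set.Ici 0] b) (𝓝 (genFun q P X b))
  rw [genFun_eq, funext (genFun_eq q P X)]
  have hlt : ∀ᶠ a in 𝓝[Set.Ici 0] b, a < b + 1 :=
    eventually_nhdsWithin_of_eventually_nhds (eventually_lt_nhds (by linarith))
  have hge : ∀ᶠ a in 𝓝[Set.Ici 0] b, 0 ≤ a := eventually_mem_nhdsWithin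
  refine tendsto_lintegral_filter_of_dominated_convergence
    (fun ω => ENNReal.ofReal (1 + (1 - q) * ((b + 1) * X ω)) ^ (1 / (1 - q)) + 1)
    (Eventually.of_forall fun a => by fun_prop) ?_ ?_ (ae_of_all _ fun ω => ?_)
  · filter_upwards [hlt, hge] with a ha ha0
    refine ae_of_all _ fun ω => ?_
    rcases le_total 0 (X ω) with h | h
    · refine le_add_right ?_
      gcongr
    · refine le_add_left (ENNReal.rpow_le_one ?_ he)
      rw [← ENNReal.ofReal_one]
      refine ENNReal.ofReal_le_ofReal ?_
      have := mul_nonpos_of_nonneg_of_nonpos hq.le (mul_nonpos_of_nonneg_of_nonpos ha0 h)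
      linarith
  · rw [lintegral_add_right _ measurable_const, ← genFun_eq]
    simpa using (hA (b + 1) (by linarith)).ne
  · refine ((ENNReal.continuous_rpow_const.comp (ENNReal.continuous_ofReal.comp ?_)).tendsto
      b).mono_left nhdsWithin_le_nhds
    fun_prop

theorem continuousOn_theta [IsProbabilityMeasure P] (hX : Measurable X) (hq1 : q < 1)
    (hA : ∀ a : ℝ, 0 < a → genFun q P X a < ∞) :
    ContinuousOn (theta q P X) (Set.Ici 0) := by
  intro b hb
  have hq : 0 < 1 - q := by linarith
  have hb0 : 0 ≤ b := hb
  have hg : Tendsto (fun a => genFun q P X a ^ (1 - q)) (𝓝[Set.Ici 0] b)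
      (𝓝 (genFun q P X b ^ (1 - q))) :=
    (ENNReal.continuous_rpow_const.tendsto _).comp (continuousOn_genFun hX hq1 hA b hb)
  refine ENNReal.Tendsto.div
    ((ENNReal.continuous_ofReal.tendsto b).mono_left nhdsWithin_le_nhds) ?_ hg
    (Or.inr ENNReal.ofReal_ne_top)
  -- The indeterminate `0 / 0` is excluded: at `b = 0` the denominator is `1`, elsewhere the
  -- numerator is positive.
  rcases hb0.eq_or_lt with rfl | h
  · right; simp [genFun_zero]
  · left; simpa using h

/-- Every `t` in `(0, θ̄)` is a value of `θ`. -/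
theorem exists_theta_eq [IsProbabilityMeasure P] (hX : Measurable X) (hq1 : q < 1)
    (hA : ∀ a : ℝ, 0 < a → genFun q P X a < ∞) {t : ℝ} (ht : 0 < t)
    (ht' : ENNReal.ofReal t < thetaBar q P X) :
    ∃ a ∈ Set.Ioi (0 : ℝ), theta q P X a = ENNReal.ofReal t := by
  obtain ⟨b, hb, hb0⟩ := ((frequently_lt_of_lt_limsup (by isBoundedDefault) ht').and_eventually
    (eventually_gt_atTop (0 : ℝ))).exists
  have h0 : theta q P X 0 ≤ ENNReal.ofReal t := by simp [theta]
  obtain ⟨a, ha, hat⟩ := isPreconnected_Ici.intermediate_value (Set.self_mem_Ici (a := (0 : ℝ)))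
    (Set.mem_Ici.2 hb0.le) (continuousOn_theta hX hq1 hA) ⟨h0, hb.le⟩
  refine ⟨a, Set.mem_Ioi.2 (lt_of_le_of_ne ha ?_), hat⟩
  rintro rfl
  have : ENNReal.ofReal t = 0 := by rw [← hat]; simp [theta]
  rw [ENNReal.ofReal_eq_zero] at this
  linarith

/-- The terms `θ x - Φ(θ)` of the rate function in terms of the parameter `a`. -/
theorem exists_mul_sub_Phi_eq [IsProbabilityMeasure P] (hX : Measurable X) (hq1 : q < 1)
    (hA : ∀ a : ℝ, 0 < a → genFun q P X a < ∞) {t : ℝ} (ht : 0 < t)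
    (ht' : ENNReal.ofReal t < thetaBar q P X) :
    ∃ a : ℝ, 0 < a ∧ 0 < (genFun q P X a).toReal ∧ ∀ x : ℝ, t * x - Phi q P X t =
      ((1 + (1 - q) * (a * x)) / (genFun q P X a).toReal ^ (1 - q) - 1) / (1 - q) := by
  have hq : 0 < 1 - q := by linarith
  have hex := exists_theta_eq hX hq1 hA ht ht'
  have ha : 0 < aOfTheta q P X t := Function.invFunOn_mem hex
  have hat : theta q P X (aOfTheta q P X t) = ENNReal.ofReal t := Function.invFunOn_eq hex
  have hPhi : Phi q P X t = qLog (2 - q) (genFun q P X (aOfTheta q P X t)).toReal := rfl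
  -- Any preimage of `t` serves, so injectivity of `θ` plays no role.
  generalize aOfTheta q P X t = a at ha hat hPhi
  have hG0 : genFun q P X a ≠ 0 := by
    intro h
    rw [theta, h, ENNReal.zero_rpow_of_pos hq, ENNReal.div_zero (by simpa using ha)] at hat
    exact ENNReal.ofReal_ne_top hat.symm
  have hG : 0 < (genFun q P X a).toReal := ENNReal.toReal_pos hG0 (hA a ha).ne
  have hta : t = a / (genFun q P X a).toReal ^ (1 - q) := by
    have := congrArg ENNReal.toReal hat
    rw [theta, ENNReal.toReal_div, ENNReal.toReal_ofReal ha.le, ENNReal.toReal_ofReal ht.le,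
      ← ENNReal.toReal_rpow] at this
    exact this.symm
  refine ⟨a, ha, hG, fun x => ?_⟩
  rw [hPhi, qLog, show (1 - (2 - q)) = -(1 - q) by ring, Real.rpow_neg hG.le, hta]
  have hp : 0 < (genFun q P X a).toReal ^ (1 - q) := by positivity
  field_simp
  ring

/-- If the rate function is infinite at `x`, then `X < x` almost surely. -/
theorem measure_le_eq_zero_of_rate_eq_top [IsProbabilityMeasure P] (hX : Measurable X)
    (hq1 : q < 1) (hA : ∀ a : ℝ, 0 < a → genFun q P X a < ∞) {x : ℝ}
    (hx : rate q P X x = ⊤) : P {ω | x ≤ X ω} = 0 := by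
  by_contra hP
  have hq : 0 < 1 - q := by linarith
  have hp : 0 < P.real {ω | x ≤ X ω} := ENNReal.toReal_pos hP (measure_ne_top _ _)
  -- Markov's inequality for `[1 + (1-q)aX]_+^(1/(1-q))` bounds every term of the supremum
  -- independently of `a`.
  have hbound : rate q P X x ≤
      ((((P.real {ω | x ≤ X ω}) ^ (1 - q))⁻¹ / (1 - q) : ℝ) : EReal) := by
    refine iSup₂_le fun t ht => EReal.coe_le_coe_iff.2 ?_
    obtain ⟨a, ha, hG, h⟩ := exists_mul_sub_Phi_eq hX hq1 hA ht.1 ht.2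
    rw [h]
    have hGp : 0 < (genFun q P X a).toReal ^ (1 - q) := by positivity
    have hpp : 0 < P.real {ω | x ≤ X ω} ^ (1 - q) := by positivity
    suffices hs : (1 + (1 - q) * (a * x)) / (genFun q P X a).toReal ^ (1 - q) ≤
        (P.real {ω | x ≤ X ω} ^ (1 - q))⁻¹ by
      gcongr
      linarith
    rcases le_total (1 + (1 - q) * (a * x)) 0 with hr | hr
    · exact (div_nonpos_of_nonpos_of_nonneg hr hGp.le).trans (inv_nonneg.2 hpp.le)
    rw [div_le_iff₀ hGp, ← div_eq_inv_mul, le_div_iff₀ hpp]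
    have h1 : ENNReal.ofReal (1 + (1 - q) * (a * x)) ^ (1 / (1 - q)) * P {ω | x ≤ X ω} ≤
        genFun q P X a := by
      rw [genFun_eq, ← setLIntegral_const]
      refine (setLIntegral_mono' (measurableSet_le measurable_const hX) fun ω hω => ?_).trans
        (setLIntegral_le_lintegral _ _)
      have : x ≤ X ω := hω
      gcongr
    have h3 := Real.rpow_le_rpow (by positivity) (ENNReal.toReal_mono (hA a ha).ne h1) hq.le
    rw [ENNReal.toReal_mul, Real.mul_rpow (by positivity) (by positivity), ← ENNReal.toReal_rpow,
      ENNReal.toReal_ofReal hr, ← Real.rpow_mul hr, one_div_mul_cancel hq.ne', Real.rpow_one] at h3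
    exact h3
  rw [hx, top_le_iff] at hbound
  exact EReal.coe_ne_top _ hbound

/-- If the rate function exceeds `1 / q` at `x`, then `1 + (1 - q) a x` exceeds the norm of
`[1 + (1 - q) a X]_+` of order `1 / (1 - q)` for some `a > 0`. -/
theorem exists_genFun_rpow_lt_of_lt_rate [IsProbabilityMeasure P] (hX : Measurable X)
    (hq0 : 0 < q) (hq1 : q < 1) (hA : ∀ a : ℝ, 0 < a → genFun q P X a < ∞) {x : ℝ}
    (hx : ((1 / q : ℝ) : EReal) < rate q P X x) :
    ∃ a : ℝ, 0 < a ∧ (genFun q P X a).toReal ^ (1 - q) < 1 + (1 - q) * (a * x) := by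
  have hq : 0 < 1 - q := by linarith
  obtain ⟨t, ht⟩ := lt_iSup_iff.1 hx
  obtain ⟨ht0, ht⟩ := lt_iSup_iff.1 ht
  obtain ⟨a, ha, hG, h⟩ := exists_mul_sub_Phi_eq hX hq1 hA ht0.1 ht0.2
  rw [h, EReal.coe_lt_coe_iff] at ht
  refine ⟨a, ha, ?_⟩
  have hGp : 0 < (genFun q P X a).toReal ^ (1 - q) := by positivity
  have h0 : 0 < (1 + (1 - q) * (a * x)) / (genFun q P X a).toReal ^ (1 - q) - 1 := by
    by_contra! hn
    have := div_nonpos_of_nonpos_of_nonneg hn hq.le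
    have : 0 < 1 / q := by positivity
    linarith
  rw [sub_pos, one_lt_div hGp] at h0
  exact h0

/-- Hölder's inequality against the constant `1`, with conjugate exponents `1/(1-q)` and `1/q`. -/
theorem integral_max_le_genFun_rpow [IsProbabilityMeasure P] (hX : Measurable X) (hq0 : 0 < q)
    (hq1 : q < 1) {a : ℝ} (hA : genFun q P X a < ∞) :
    ∫ ω, max (1 + (1 - q) * (a * X ω)) 0 ∂P ≤ (genFun q P X a).toReal ^ (1 - q) := by
  have hq : 0 < 1 - q := by linarith
  have hm : Measurable fun ω => ENNReal.ofReal (1 + (1 - q) * (a * X ω)) := by fun_prop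
  have hc : (1 / (1 - q)).HolderConjugate (1 / q) := by
    rw [Real.holderConjugate_iff]
    refine ⟨by rw [lt_div_iff₀ hq]; linarith, by simp⟩
  have h := ENNReal.lintegral_mul_le_Lp_mul_Lq P hc hm.aemeasurable
    (aemeasurable_const (b := (1 : ℝ≥0∞)))
  rw [← genFun_eq] at h
  simp only [Pi.mul_apply, mul_one, ENNReal.one_rpow, lintegral_const, measure_univ, one_div,
    inv_inv] at h
  rw [integral_eq_lintegral_of_nonneg_ae (f := fun ω => max (1 + (1 - q) * (a * X ω)) 0)
    (ae_of_all _ fun ω => le_max_right _ _) (by fun_prop), ENNReal.toReal_rpow]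
  refine ENNReal.toReal_mono (ENNReal.rpow_ne_top_of_nonneg hq.le hA.ne) ?_
  simpa [ENNReal.ofReal_max] using h

theorem integrable_max_rpow (hX : Measurable X) (hq1 : q < 1) {a : ℝ}
    (hA : genFun q P X a < ∞) :
    Integrable (fun ω => max (1 + (1 - q) * (a * X ω)) 0 ^ (1 / (1 - q))) P := by
  have hq : 0 < 1 - q := by linarith
  have hm : Measurable fun ω => max (1 + (1 - q) * (a * X ω)) 0 := by fun_prop
  refine ⟨(hm.pow_const _).aestronglyMeasurable, ?_⟩
  rw [hasFiniteIntegral_iff_ofReal (ae_of_all _ fun ω => by positivity)]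
  refine lt_of_eq_of_lt ?_ hA
  rw [genFun_eq]
  refine lintegral_congr fun ω => ?_
  rw [← ENNReal.ofReal_rpow_of_nonneg (le_max_right _ _) (by positivity)]
  simp [ENNReal.ofReal_max]

end QDeformed

/-! ### Comparison of the probabilities with the target -/

namespace QDeformed

variable {Ω : Type*} [MeasurableSpace Ω] {P : Measure Ω} {X : ℕ → Ω → ℝ} {q : ℝ}

theorem one_le_qExp_of_nonneg (hq1 : q < 1) {u : EReal} (hu : 0 ≤ u) : 1 ≤ qExp (2 - q) u := by
  have hc : (1 - (2 - q)) < 0 := by linarith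
  rw [qExp, show 1 / (1 - (2 - q)) = -(1 / (1 - q)) by rw [← neg_div_neg_eq]; ring,
    ENNReal.rpow_neg, ENNReal.one_le_inv]
  refine ENNReal.rpow_le_one ?_ (one_div_nonneg.2 (by linarith))
  rw [← show (1 : EReal).toENNReal = 1 from EReal.toENNReal_coe (x := 1)]
  refine EReal.toENNReal_le_toENNReal ?_
  have : (((1 - (2 - q) : ℝ)) : EReal) * u ≤ 0 :=
    EReal.mul_nonpos_iff.2 (Or.inr ⟨by exact_mod_cast hc.le, hu⟩)
  simpa using add_le_add_right this 1

/-- Probabilities that the mean of `n` of the variables is at least `x`, when `x` lies above the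
normalized mean for the parameter `a`. -/
theorem tendsto_rpow_mul_measureReal_mean [IsProbabilityMeasure P]
    (hmeas : ∀ k, Measurable (X k)) (hindep : iIndepFun X P)
    (hident : ∀ k, IdentDistrib (X k) (X 0) P P) (hq0 : 0 < q) (hq1 : q < 1) {a x : ℝ}
    (ha : 0 < a) (hA : genFun q P (X 0) a < ∞)
    (hax : (genFun q P (X 0) a).toReal ^ (1 - q) < 1 + (1 - q) * (a * x)) :
    Tendsto (fun n : ℕ => (n : ℝ) ^ (1 / (1 - q) - 1) *
      P.real {ω | x ≤ (1 / (n : ℝ)) * ∑ k ∈ Finset.range n, X k ω}) atTop (𝓝 0) := by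
  have hq : 0 < 1 - q := by linarith
  have hg : Measurable fun y : ℝ => max (1 + (1 - q) * (a * y)) 0 := by fun_prop
  have hT := tendsto_rpow_mul_measureReal_sum
    (Z := fun k ω => max (1 + (1 - q) * (a * X k ω)) 0) (r := 1 + (1 - q) * (a * x))
    (fun k => hg.comp (hmeas k)) (hindep.comp (fun _ y => max (1 + (1 - q) * (a * y)) 0)
      fun _ => hg) (fun k => (hident k).comp hg) (fun ω => le_max_right _ _)
    (by rw [lt_div_iff₀ hq]; linarith) (integrable_max_rpow (hmeas 0) hq1 hA)
    ((integral_max_le_genFun_rpow (hmeas 0) hq0 hq1 hA).trans_lt hax)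
  refine squeeze_zero' (Eventually.of_forall fun n => by positivity) ?_ hT
  filter_upwards [eventually_ge_atTop 1] with n hn
  have hn0 : (0 : ℝ) < n := by exact_mod_cast hn
  refine mul_le_mul_of_nonneg_left (measureReal_mono fun ω hω => ?_) (by positivity)
  have h1 : n * x ≤ ∑ k ∈ Finset.range n, X k ω := by
    have h : x ≤ (1 / (n : ℝ)) * ∑ k ∈ Finset.range n, X k ω := hω
    rwa [one_div, ← div_eq_inv_mul, le_div_iff₀' hn0] at h
  -- Passing to positive parts only enlarges the sum, so the event for the mean lies in the event
  -- for the `Z_k`.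
  have h2 : ∑ k ∈ Finset.range n, (1 + (1 - q) * (a * X k ω)) ≤
      ∑ k ∈ Finset.range n, max (1 + (1 - q) * (a * X k ω)) 0 :=
    Finset.sum_le_sum fun k _ => le_max_left _ _
  rw [Finset.sum_add_distrib, ← Finset.mul_sum, ← Finset.mul_sum] at h2
  simp only [Finset.sum_const, Finset.card_range, nsmul_eq_mul, mul_one] at h2
  refine le_trans ?_ h2
  rw [mul_add, mul_one, show (n : ℝ) * ((1 - q) * (a * x)) = (1 - q) * (a * (n * x)) by ring]
  gcongr

theorem measure_mean_eq_zero (hident : ∀ k, IdentDistrib (X k) (X 0) P P) {x : ℝ}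
    (h0 : P {ω | x ≤ X 0 ω} = 0) {n : ℕ} (hn : 1 ≤ n) :
    P {ω | x ≤ (1 / (n : ℝ)) * ∑ k ∈ Finset.range n, X k ω} = 0 := by
  have hk (k : ℕ) : P {ω | x ≤ X k ω} = 0 :=
    ((hident k).measure_mem_eq (measurableSet_Ici (a := x))).trans h0
  refine measure_mono_null (fun ω hω => ?_) (measure_iUnion_null hk)
  by_contra hcon
  simp only [Set.mem_iUnion, Set.mem_ofPred_eq, not_exists, not_le] at hcon
  have hn0 : (0 : ℝ) < n := by exact_mod_cast hn
  have h : x ≤ (1 / (n : ℝ)) * ∑ k ∈ Finset.range n, X k ω := hω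
  rw [one_div, ← div_eq_inv_mul, le_div_iff₀' hn0] at h
  have := Finset.sum_lt_sum_of_nonempty (s := Finset.range n)
    (Finset.nonempty_range_iff.2 (by omega)) fun k _ => hcon k
  simp only [Finset.sum_const, Finset.card_range, nsmul_eq_mul] at this
  linarith

/-- The large deviation bound, for all large `n`. -/
theorem eventually_measure_mean_le [IsProbabilityMeasure P]
    (hmeas : ∀ k, Measurable (X k)) (hindep : iIndepFun X P)
    (hident : ∀ k, IdentDistrib (X k) (X 0) P P) (hq0 : 0 < q) (hq1 : q < 1)
    (hA : ∀ a : ℝ, 0 < a → genFun q P (X 0) a < ∞) (x : ℝ) :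
    ∀ᶠ n : ℕ in atTop, P {ω | x ≤ (1 / (n : ℝ)) * ∑ k ∈ Finset.range n, X k ω} ≤
      (n : ℝ≥0∞) * qExp (2 - q)
        (((n / q : ℝ) : EReal) - (n : EReal) * rate q P (X 0) x) := by
  have hq : 0 < 1 - q := by linarith
  rcases le_or_gt (rate q P (X 0) x) ((1 / q : ℝ) : EReal) with hle | hlt
  · filter_upwards [eventually_ge_atTop 1] with n hn
    have hu : (n : EReal) * rate q P (X 0) x ≤ ((n / q : ℝ) : EReal) := by
      refine (mul_le_mul_of_nonneg_left hle (by positivity)).trans (le_of_eq ?_)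
      rw [div_eq_mul_one_div (n : ℝ), EReal.coe_mul]
      rfl
    have hnonneg : 0 ≤ ((n / q : ℝ) : EReal) - (n : EReal) * rate q P (X 0) x :=
      (EReal.sub_nonneg (Or.inl (EReal.coe_ne_top _)) (Or.inl (EReal.coe_ne_bot _))).2 hu
    calc _ ≤ (1 : ℝ≥0∞) := prob_le_one
      _ = 1 * 1 := (one_mul 1).symm
      _ ≤ _ := mul_le_mul' (by exact_mod_cast hn) (one_le_qExp_of_nonneg hq1 hnonneg)
  · rcases eq_or_ne (rate q P (X 0) x) ⊤ with htop | htop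
    · filter_upwards [eventually_ge_atTop 1] with n hn
      rw [measure_mean_eq_zero hident
        (measure_le_eq_zero_of_rate_eq_top (hmeas 0) hq1 hA htop) hn]
      exact zero_le
    · obtain ⟨a, ha, hax⟩ := exists_genFun_rpow_lt_of_lt_rate (hmeas 0) hq0 hq1 hA hlt
      lift rate q P (X 0) x to ℝ using ⟨htop, (bot_le.trans_lt hlt).ne'⟩ with ρ
      rw [EReal.coe_lt_coe_iff] at hlt
      -- The target equals `n (1 + n c)^(-1/(1-q))`, and `1 + n c ≤ n (1 + c)` bounds it below by a
      -- constant times `n^(1 - 1/(1-q))`.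
      set c := (1 - q) * (ρ - 1 / q) with hc
      have hc0 : 0 < c := mul_pos hq (by linarith)
      have hT := tendsto_rpow_mul_measureReal_mean hmeas hindep hident hq0 hq1 ha (hA a ha) hax
      filter_upwards [eventually_ge_atTop 1,
        hT.eventually_le_const (by positivity : 0 < (1 + c) ^ (-(1 / (1 - q))))] with n hn hPn
      have hn1 : (1 : ℝ) ≤ n := by exact_mod_cast hn
      have hn0 : (0 : ℝ) < n := by linarith
      have hu : ((n / q : ℝ) : EReal) - (n : EReal) * (ρ : EReal) =
          ((n / q - n * ρ : ℝ) : EReal) := by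
        push_cast; rfl
      have hbase : 1 + (1 - (2 - q)) * (n / q - n * ρ) = 1 + n * c := by
        rw [hc]; field_simp; ring
      rw [hu, qExp_coe, hbase, show 1 / (1 - (2 - q)) = -(1 / (1 - q)) by
          rw [← neg_div_neg_eq]; ring,
        ENNReal.ofReal_rpow_of_pos (by positivity), ← ENNReal.ofReal_natCast,
        ← ENNReal.ofReal_mul hn0.le, ← ofReal_measureReal]
      refine ENNReal.ofReal_le_ofReal ?_
      have h1 : ((n : ℝ) * (1 + c)) ^ (-(1 / (1 - q))) ≤ (1 + n * c) ^ (-(1 / (1 - q))) :=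
        Real.rpow_le_rpow_of_nonpos (by positivity) (by linarith)
          (neg_nonpos.2 (by positivity))
      refine le_trans ?_ (mul_le_mul_of_nonneg_left h1 hn0.le)
      rw [Real.mul_rpow hn0.le (by positivity), ← mul_assoc]
      have h2 : (n : ℝ) * (n : ℝ) ^ (-(1 / (1 - q))) = ((n : ℝ) ^ (1 / (1 - q) - 1))⁻¹ := by
        rw [← Real.rpow_neg hn0.le, mul_comm, ← Real.rpow_add_one hn0.ne']
        congr 1
        ring
      rwa [h2, ← div_eq_inv_mul, le_div_iff₀' (by positivity)]

end QDeformed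

theorem theorem2 {Ω : Type*} [MeasurableSpace Ω] (P : Measure Ω) [IsProbabilityMeasure P]
    (X : ℕ → Ω → ℝ) (hmeas : ∀ k, Measurable (X k)) (hindep : iIndepFun X P)
    (hident : ∀ k, IdentDistrib (X k) (X 0) P P)
    (q : ℝ) (hq0 : 0 < q) (hq1 : q < 1)
    (hA : ∀ a : ℝ, 0 < a → QDeformed.genFun q P (X 0) a < ∞) :
    ∃ ξ : ℕ → ℝ → ℝ≥0∞,
      (∀ n : ℕ, 1 ≤ n → ∀ x : ℝ,
        P {ω | x ≤ (1 / (n : ℝ)) * ∑ k ∈ Finset.range n, X k ω} ≤ ξ n x) ∧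
      ∀ x : ℝ, QDeformed.AsympEquiv (fun n => ξ n x)
        (fun n => (n : ℝ≥0∞) *
          QDeformed.qExp (2 - q)
            (((n / q : ℝ) : EReal) - (n : EReal) * QDeformed.rate q P (X 0) x)) := by
  -- Once the target dominates, the maximum equals it, so the quotient can be taken as `1`.
  refine ⟨fun n x => max (P {ω | x ≤ (1 / (n : ℝ)) * ∑ k ∈ Finset.range n, X k ω})
    ((n : ℝ≥0∞) * QDeformed.qExp (2 - q)
      (((n / q : ℝ) : EReal) - (n : EReal) * QDeformed.rate q P (X 0) x)),
    fun n _ x => le_max_left _ _, fun x => ⟨fun _ => 1, tendsto_const_nhds, ?_⟩⟩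
  filter_upwards [QDeformed.eventually_measure_mean_le hmeas hindep hident hq0 hq1 hA x] with n hn
  rw [one_mul, max_eq_right hn]
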